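/- Let $d\in\mathbb{N}$ and let $A\subset\mathbb{R}^d$ be a Cantor set, that is, a subset homeomorphic to $\{0,1\}^{\mathbb{N}}$. Call $f:\mathbb{R}^d\to\mathbb{R}^d$ bi-Lipschitz if there are constants $K,L\ge 0$ with $|f(x)-f(y)|\le K|x-y|$ and $|x-y|\le L|f(x)-f(y)|$ for all $x,y\in\mathbb{R}^d$. Then the following two statements hold, where $|\cdot|$ applied to sets denotes Lebesgue measure on $\mathbb{R}^d$. (1) There exists an $F_\sigma$ set $B\subset\mathbb{R}^d$ with $|B|=0$ such that $$\bigl|\mathbb{R}^d\setminus (f(A)+B)\bigr|=0$$ for all bi-Lipschitz functions $f:\mathbb{R}^d\to\mathbb{R}^d$, where $f(A)+B=\{f(a)+b: a\in A,\ b\in B\}$. (2) There exists a dense $G_\delta$ set $X\subset\mathbb{R}^d$ of full measure, i.e. $|\mathbb{R}^d\setminus X|=0$, such that for every bi-Lipschitz function $f:\mathbb{R}^d\to\mathbb{R}^d$, $$\bigl|\{t\in\mathbb{R}^d : f(A)+t\subseteq X\}\bigr|=0.$$ -/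

import Mathlib

open MeasureTheory
open scoped Pointwise NNReal

/-- A (topological) Cantor set in `X`: a subset that, with the subspace topology, is homeomorphic
to the Cantor space `{0,1}^ℕ` with the product topology. -/
def IsCantorSet {X : Type*} [TopologicalSpace X] (A : Set X) : Prop :=
  Nonempty (A ≃ₜ (ℕ → Bool))

/-- An `F_σ` set: a countable union of closed sets. -/
def IsFSigma {X : Type*} [TopologicalSpace X] (B : Set X) : Prop :=
  ∃ F : ℕ → Set X, (∀ n, IsClosed (F n)) ∧ B = ⋃ n, F n

/-- A bi-Lipschitz map: for some constants `K`, `L`, one has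
`dist (f x) (f y) ≤ K * dist x y` and `dist x y ≤ L * dist (f x) (f y)` for all `x`, `y`. -/
def IsBiLipschitz {X Y : Type*} [PseudoEMetricSpace X] [PseudoEMetricSpace Y] (f : X → Y) : Prop :=
  (∃ K : ℝ≥0, LipschitzWith K f) ∧ ∃ L : ℝ≥0, AntilipschitzWith L f

/-!
The second assertion is the complementary form of the first: for `X = Bᶜ` the set `f '' A + t` lies
in `X` only if `t` avoids `-f '' A + B`. For the first assertion it suffices to find a single
compact null set `C` such that `f '' A + C` has positive measure for every bi-Lipschitz `f`, since
adding a countable dense set then turns positive measure into full measure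
(`measure_compl_add_eq_zero_of_dense`).

The set `C` is the intersection of a decreasing sequence of compact sets `C k`, with `ν (C k)` of
order `2 ^ (-k)`. Fix an atomless probability measure `μ` on `A`. By Cauchy–Schwarz
(`measure_sq_le_translateEnergy_mul`), `ν (f '' A + C k)` is at least `ν (C k) ^ 2` divided by the
energy `∬ ν ((f a + C k) ∩ (f b + C k)) dμ(a) dμ(b)`, so it is enough to bound `4 ^ k` times the
energy as `k` grows.

This is achieved by halving each `C k` in a pseudo-random way (`exists_isCompact_half`): for
prescribed `s` and `ε`, one has `4 ν (C' ∩ (C' - z)) ≤ ν (C ∩ (C - z)) + ε` as soon as `‖z‖ ≥ s`.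
Such a `C'` is obtained by keeping the half of `C` on which a sign `r` is `1`. The sign is built
on small balls one after the other, on each of them with so high a frequency that it is nearly
orthogonal to every translate of the weight built so far (`exists_reweighting`); this rests on a
Riemann–Lebesgue lemma which is uniform in translations. The estimate concerns the displacement
`z` alone, hence it serves all maps `f` at once. The pairs `(a, b)` with `‖f a - f b‖ < s` satisfy
`dist a b ≤ L * s`, where `L` is the expansion constant of `f`, and they have small `μ × μ` measure
because `μ` has no atoms. Admitting the constant `L = k` at the `k`-th step covers every
bi-Lipschitz `f` from some step on.
-/

open Set Filter Topology
open scoped ENNReal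

/-! ### Rapidly oscillating signs -/

/-- Every nonzero `v` is an antiperiod of a measurable sign: take `(-1) ^ ⌊ℓ t⌋` for a linear
functional `ℓ` with `ℓ v = 1`. -/
theorem exists_antiperiodic_sign {E : Type*} [NormedAddCommGroup E] [NormedSpace ℝ E]
    [MeasurableSpace E] [BorelSpace E] {v : E} (hv : v ≠ 0) :
    ∃ r : E → ℝ, Measurable r ∧ (∀ t, r t = 1 ∨ r t = -1) ∧ ∀ t, r (t + v) = -r t := by
  obtain ⟨l, hl⟩ := SeparatingDual.exists_eq_one (R := ℝ) hv
  refine ⟨fun t => if Even ⌊l t⌋ then 1 else -1, ?_, fun t => ?_, fun t => ?_⟩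
  · refine Measurable.ite ?_ measurable_const measurable_const
    exact (Int.measurable_floor.comp l.continuous.measurable)
      (MeasurableSet.of_discrete (s := {n : ℤ | Even n}))
  · dsimp only
    split_ifs <;> simp
  · simp only [map_add, hl, Int.floor_add_one, Int.even_add_one]
    split_ifs <;> simp_all

theorem abs_integral_mul_le_of_antiperiodic {E : Type*} [AddGroup E] [MeasurableSpace E]
    [MeasurableAdd E] (ν : Measure E) [ν.IsAddRightInvariant] {G r : E → ℝ} {v : E} (hG : Integrable G ν)
    (hrm : Measurable r) (hr : ∀ t, r t = 1 ∨ r t = -1) (hrv : ∀ t, r (t + v) = -r t) :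
    |∫ t, G t * r t ∂ν| ≤ ∫ t, |G (t + v) - G t| ∂ν := by
  have hr1 : ∀ t, |r t| = 1 := fun t => by rcases hr t with h | h <;> simp [h]
  have hint : ∀ {H : E → ℝ}, Integrable H ν → Integrable (fun t => H t * r t) ν := fun hH =>
    hH.mul_bdd (c := 1) hrm.aestronglyMeasurable (ae_of_all _ fun t => by simp [hr1])
  have hGv : Integrable (fun t => G (t + v)) ν := hG.comp_add_right v
  have h1 : ∫ t, G t * r t ∂ν = -∫ t, G (t + v) * r t ∂ν := by
    rw [← integral_add_right_eq_self (fun t => G t * r t) v, ← integral_neg]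
    simp [hrv]
  have h2 : ∫ t, (G (t + v) - G t) * r t ∂ν = -2 * ∫ t, G t * r t ∂ν := by
    simp only [sub_mul]
    rw [integral_sub (hint hGv) (hint hG)]
    linarith
  have h3 : |∫ t, (G (t + v) - G t) * r t ∂ν| ≤ ∫ t, |G (t + v) - G t| ∂ν := by
    refine abs_integral_le_integral_abs.trans_eq ?_
    simp [abs_mul, hr1]
  rw [h2, abs_mul] at h3
  norm_num at h3
  linarith [abs_nonneg (∫ t, G t * r t ∂ν)]

section HaarMeasure

variable {E : Type*} [NormedAddCommGroup E] [NormedSpace ℝ E] [FiniteDimensional ℝ E]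
  [MeasurableSpace E] [BorelSpace E] (ν : Measure E) [ν.IsAddHaarMeasure]

/-- Continuity of translation in `L¹`. -/
theorem tendsto_integral_abs_translate_sub {g : E → ℝ} (hg : Integrable g ν) :
    Tendsto (fun v => ∫ t, |g (t + v) - g t| ∂ν) (𝓝 0) (𝓝 0) := by
  have := FiniteDimensional.proper ℝ E
  have : Fact ((1 : ℝ≥0∞) ≠ ∞) := ⟨ENNReal.one_ne_top⟩
  have h : Continuous fun v : E => DomAddAct.mk v +ᵥ hg.toL1 g :=
    DomAddAct.continuous_mk.vadd continuous_const
  have h0 := (h.tendsto 0).dist (tendsto_const_nhds (x := hg.toL1 g))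
  simp only [DomAddAct.mk_zero, zero_vadd, dist_self] at h0
  refine h0.congr fun v => ?_
  rw [L1.dist_eq_integral_dist]
  refine integral_congr_ae ?_
  have h1 := (measurePreserving_add_left ν v).quasiMeasurePreserving.ae hg.coeFn_toL1
  filter_upwards [DomAddAct.vadd_Lp_ae_eq (DomAddAct.mk v) (hg.toL1 g), hg.coeFn_toL1, h1]
    with t a b c
  rw [a, b, Equiv.symm_apply_apply, vadd_eq_add, c, Real.dist_eq, add_comm t v]

/-- A Riemann–Lebesgue lemma that is uniform in translations: some sign `r` is nearly orthogonal
to `h` and to all the products of `h` with a translate of `g`. -/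
theorem exists_sign_abs_integral_translate_mul_le [Nontrivial E] {g h : E → ℝ} {B : ℝ}
    (hg : Integrable g ν) (hh : Integrable h ν) (hgB : ∀ t, |g t| ≤ B) (hhB : ∀ t, |h t| ≤ B)
    {ε : ℝ} (hε : 0 < ε) :
    ∃ r : E → ℝ, Measurable r ∧ (∀ t, r t = 1 ∨ r t = -1) ∧ |∫ t, h t * r t ∂ν| ≤ ε ∧
      ∀ z, |∫ t, g (t + z) * (h t * r t) ∂ν| ≤ ε := by
  have hB : 0 ≤ B := (abs_nonneg _).trans (hgB 0)
  have Tg := tendsto_integral_abs_translate_sub ν hg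
  have Th := tendsto_integral_abs_translate_sub ν hh
  have T := (Th.const_mul B).add (Tg.const_mul B)
  simp only [mul_zero, add_zero] at T
  have ev := (((Th.eventually_le_const hε).and (T.eventually_le_const hε)).filter_mono
    nhdsWithin_le_nhds).and (self_mem_nhdsWithin (s := {(0 : E)}ᶜ))
  obtain ⟨v, ⟨hv1, hv2⟩, hv0⟩ := ev.exists
  obtain ⟨r, hrm, hr, hrv⟩ := exists_antiperiodic_sign hv0
  refine ⟨r, hrm, hr, (abs_integral_mul_le_of_antiperiodic ν hh hrm hr hrv).trans hv1,
    fun z => ?_⟩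
  have hgz : Integrable (fun t => g (t + z)) ν := hg.comp_add_right z
  have hG : Integrable (fun t => g (t + z) * h t) ν :=
    hh.bdd_mul (c := B) hgz.aestronglyMeasurable (ae_of_all _ fun t => hgB _)
  simp only [← mul_assoc]
  refine (abs_integral_mul_le_of_antiperiodic ν hG hrm hr hrv).trans (le_trans ?_ hv2)
  have hdh : Integrable (fun t => |h (t + v) - h t|) ν := ((hh.comp_add_right v).sub hh).abs
  have hdg : Integrable (fun t => |g (t + v) - g t|) ν := ((hg.comp_add_right v).sub hg).abs
  have hdgz : Integrable (fun t => |g (t + z + v) - g (t + z)|) ν := hdg.comp_add_right z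
  rw [← integral_add_right_eq_self (fun t => |g (t + v) - g t|) z, ← integral_const_mul,
    ← integral_const_mul, ← integral_add (hdh.const_mul B) (hdgz.const_mul B)]
  refine integral_mono ((hG.comp_add_right v).sub hG).abs
    ((hdh.const_mul B).add (hdgz.const_mul B)) fun t => ?_
  have e : g (t + v + z) * h (t + v) - g (t + z) * h t =
      g (t + v + z) * (h (t + v) - h t) + h t * (g (t + z + v) - g (t + z)) := by
    rw [add_right_comm t v z]; ring
  simp only [e]
  refine (abs_add_le _ _).trans ?_
  rw [abs_mul, abs_mul]
  gcongr
  · exact hgB _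
  · exact hhB _

/-! ### Halving a compact set without increasing its normalized correlations -/

/-- Multiplying the indicator of `C` by `1 + r` for a sign `r`, one small ball at a time. At each
ball the correlations `∫ w (t + z) * w t` with `‖z‖ ≥ s` change by two cross terms only, which
are small for a rapidly oscillating `r`; the quadratic term vanishes because no two points of the
ball differ by `z`. -/
theorem exists_reweighting [Nontrivial E] {C : Set E} (hC : IsCompact C) {s : ℝ}
    {T : Set E} (hT : T.Finite) : ∀ {ε : ℝ}, 0 < ε →
    ∃ w : E → ℝ, Measurable w ∧ (∀ t ∉ C, w t = 0) ∧
      (∀ t ∈ C, t ∉ ⋃ x ∈ T, Metric.ball x (s / 2) → w t = 1) ∧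
      (∀ t ∈ C, t ∈ ⋃ x ∈ T, Metric.ball x (s / 2) → w t = 0 ∨ w t = 2) ∧
      |∫ t, w t ∂ν - ν.real C| ≤ ε ∧
      ∀ z, s ≤ ‖z‖ → ∫ t, w (t + z) * w t ∂ν ≤ ν.real ((· + z) ⁻¹' C ∩ C) + ε := by
  have hCm := hC.measurableSet
  induction T, hT using Set.Finite.induction_on with
  | empty =>
    intro ε hε
    refine ⟨C.indicator 1, measurable_one.indicator hCm, fun t ht => by simp [ht],
      fun t ht _ => by simp [ht], fun t _ ht => by simp at ht, ?_, fun z _ => ?_⟩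
    · simp [integral_indicator_one hCm, hε.le]
    · have hm : MeasurableSet ((· + z) ⁻¹' C ∩ C) :=
        ((measurable_add_const z) hCm).inter hCm
      rw [← integral_indicator_one hm]
      refine (le_of_eq ?_).trans (le_add_of_nonneg_right hε.le)
      congr 1 with t
      by_cases h1 : t ∈ C <;> by_cases h2 : t + z ∈ C <;> simp [h1, h2]
  | @insert a T _ hT ih =>
    intro ε hε
    obtain ⟨w, hwm, hw0, hw1, hw2, hwi, hwc⟩ := ih (ε := ε / 3) (by positivity)
    set D := ⋃ x ∈ T, Metric.ball x (s / 2) with hD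
    have hDm : MeasurableSet D :=
      (isOpen_biUnion fun x _ => Metric.isOpen_ball).measurableSet
    set P := C ∩ (Metric.ball a (s / 2) \ D) with hP
    have hPm : MeasurableSet P := hCm.inter (measurableSet_ball.diff hDm)
    have hPfin : ν P ≠ ∞ := ((measure_mono inter_subset_left).trans_lt hC.measure_lt_top).ne
    set h : E → ℝ := P.indicator 1 with hh
    have hhm : Measurable h := measurable_one.indicator hPm
    have hhB : ∀ t, |h t| ≤ 2 := fun t => by by_cases ht : t ∈ P <;> simp [hh, ht]
    have hhi : Integrable h ν := (integrable_indicator_iff hPm).2 (integrableOn_const hPfin)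
    have hwB : ∀ t, |w t| ≤ 2 := fun t => by
      by_cases h1 : t ∈ C
      · by_cases h2 : t ∈ D
        · rcases hw2 t h1 h2 with h | h <;> simp [h]
        · simp [hw1 t h1 h2]
      · simp [hw0 t h1]
    have hwint : Integrable w ν := by
      have : IntegrableOn w C ν := Measure.integrableOn_of_bounded (M := 2)
        hC.measure_lt_top.ne hwm.aestronglyMeasurable (ae_of_all _ hwB)
      exact this.integrable_of_forall_notMem_eq_zero hw0
    obtain ⟨r, hrm, hr, hri, hrc⟩ := exists_sign_abs_integral_translate_mul_le ν hwint hhi hwB hhB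
      (show 0 < ε / 3 by positivity)
    have hvm : Measurable fun t => h t * r t := hhm.mul hrm
    have hvi : Integrable (fun t => h t * r t) ν :=
      hhi.mul_bdd (c := 1) hrm.aestronglyMeasurable
        (ae_of_all _ fun t => by rcases hr t with e | e <;> simp [e])
    have hDi : ⋃ x ∈ insert a T, Metric.ball x (s / 2) = Metric.ball a (s / 2) ∪ D := by
      rw [biUnion_insert]
    rw [hDi]
    refine ⟨fun t => w t + h t * r t, hwm.add hvm, fun t ht => ?_, fun t htC htD => ?_,
      fun t htC htD => ?_, ?_, fun z hz => ?_⟩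
    · have : t ∉ P := fun h => ht h.1
      simp [hw0 t ht, hh, this]
    · have h1 : t ∉ P := fun h => htD (Or.inl h.2.1)
      simp [hw1 t htC fun h => htD (Or.inr h), hh, h1]
    · by_cases htD' : t ∈ D
      · have h1 : t ∉ P := fun h => h.2.2 htD'
        simpa [hh, h1] using hw2 t htC htD'
      · have h1 : t ∈ P := ⟨htC, htD.resolve_right htD', htD'⟩
        rcases hr t with e | e <;> simp [hw1 t htC htD', hh, h1, e]
        norm_num
    · rw [integral_add hwint hvi]
      rw [abs_le] at *
      constructor <;> linarith
    · have hzero : ∀ t, (h (t + z) * r (t + z)) * (h t * r t) = 0 := fun t => by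
        by_cases h1 : t ∈ P
        · by_cases h2 : t + z ∈ P
          · exfalso
            have d1 := Metric.mem_ball.1 h1.2.1
            have d2 := Metric.mem_ball.1 h2.2.1
            have d3 := dist_triangle_right (t + z) t a
            rw [dist_eq_norm, add_sub_cancel_left] at d3
            linarith
          · simp [hh, h2]
        · simp [hh, h1]
      have i1 : Integrable (fun t => w (t + z) * w t) ν :=
        hwint.bdd_mul (c := 2) (hwm.comp (measurable_add_const z)).aestronglyMeasurable
          (ae_of_all _ fun t => hwB _)
      have i2 : Integrable (fun t => w (t + z) * (h t * r t)) ν :=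
        hvi.bdd_mul (c := 2) (hwm.comp (measurable_add_const z)).aestronglyMeasurable
          (ae_of_all _ fun t => hwB _)
      have i3 : Integrable (fun t => w t * (h (t + z) * r (t + z))) ν :=
        (hvi.comp_add_right z).bdd_mul (c := 2) hwm.aestronglyMeasurable
          (ae_of_all _ fun t => hwB _)
      have e : ∀ t, (w (t + z) + h (t + z) * r (t + z)) * (w t + h t * r t) =
          w (t + z) * w t + w (t + z) * (h t * r t) + w t * (h (t + z) * r (t + z)) := fun t => by
        linear_combination hzero t
      have i12 : Integrable (fun t => w (t + z) * w t + w (t + z) * (h t * r t)) ν := i1.add i2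
      have e3 : ∫ t, w t * (h (t + z) * r (t + z)) ∂ν = ∫ t, w (t + -z) * (h t * r t) ∂ν := by
        rw [← integral_add_right_eq_self (fun t => w (t + -z) * (h t * r t)) z]
        simp
      simp only [e]
      rw [integral_add i12 i3, integral_add i1 i2, e3]
      linarith [hwc z hz, (abs_le.1 (hrc z)).2, (abs_le.1 (hrc (-z))).2]

/-- A compact set can be halved so that its correlations at distances at least `s` become those of
a random subset of density one half, up to `ε`. -/
theorem exists_isCompact_half [Nontrivial E] {C : Set E} (hC : IsCompact C) {s ε : ℝ}
    (hs : 0 < s) (hε : 0 < ε) :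
    ∃ C' ⊆ C, IsCompact C' ∧ |2 * ν.real C' - ν.real C| ≤ ε ∧
      ∀ z, s ≤ ‖z‖ → 4 * ν.real ((· + z) ⁻¹' C' ∩ C') ≤ ν.real ((· + z) ⁻¹' C ∩ C) + ε := by
  have := FiniteDimensional.proper ℝ E
  obtain ⟨T, -, hT, hCT⟩ := hC.finite_cover_balls (half_pos hs)
  obtain ⟨w, hwm, hw0, -, hw2, hwi, hwc⟩ :=
    exists_reweighting ν hC (s := s) hT (half_pos hε)
  set S := {t | w t = 2} with hS
  have hSm : MeasurableSet S := hwm (measurableSet_singleton 2)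
  have hSC : S ⊆ C := fun t ht => by
    by_contra h
    have h2 : w t = 2 := ht
    rw [hw0 t h] at h2
    norm_num at h2
  have hw : ∀ t, w t = 2 * S.indicator 1 t := fun t => by
    by_cases ht : t ∈ S
    · rw [indicator_of_mem ht]
      simpa using (show w t = 2 from ht)
    · by_cases htC : t ∈ C
      · simpa [ht] using (hw2 t htC (hCT htC)).resolve_right ht
      · simp [ht, hw0 t htC]
  have hSfin : ν S ≠ ∞ := ((measure_mono hSC).trans_lt hC.measure_lt_top).ne
  obtain ⟨K, hKS, hK, hKε⟩ := hSm.exists_isCompact_sdiff_lt hSfin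
    (ε := ENNReal.ofReal (ε / 4)) (by simpa using hε)
  have hSi : ∫ t, w t ∂ν = 2 * ν.real S := by
    simp only [hw]
    rw [integral_const_mul, integral_indicator_one hSm]
  have hSc : ∀ z, ∫ t, w (t + z) * w t ∂ν = 4 * ν.real ((· + z) ⁻¹' S ∩ S) := fun z => by
    have hm : MeasurableSet ((· + z) ⁻¹' S ∩ S) := ((measurable_add_const z) hSm).inter hSm
    rw [← integral_indicator_one hm, ← integral_const_mul]
    congr 1 with t
    by_cases h1 : t ∈ S <;> by_cases h2 : t + z ∈ S <;> simp [h1, h2, hw]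
    norm_num
  have hKr : ν.real S - ν.real K ≤ ε / 4 := by
    have h1 : ν.real (S \ K) ≤ ε / 4 :=
      ENNReal.toReal_le_of_le_ofReal (by positivity) hKε.le
    rwa [measureReal_sdiff hKS hK.measurableSet hSfin] at h1
  have hKS' : ν.real K ≤ ν.real S := measureReal_mono hKS hSfin
  refine ⟨K, hKS.trans hSC, hK, ?_, fun z hz => ?_⟩
  · rw [hSi] at hwi
    rw [abs_le] at *
    constructor <;> linarith
  · have h1 := hwc z hz
    rw [hSc] at h1
    have h2 : ν.real ((· + z) ⁻¹' K ∩ K) ≤ ν.real ((· + z) ⁻¹' S ∩ S) :=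
      measureReal_mono (inter_subset_inter (preimage_mono hKS) hKS)
        ((measure_mono inter_subset_right).trans_lt hSfin.lt_top).ne
    linarith

/-! ### The energy of a set along a map -/

/-- An atomless finite measure gives little mass to the pairs of nearby points. -/
theorem exists_prod_dist_le_lt {X : Type*} [MetricSpace X] [SecondCountableTopology X]
    [MeasurableSpace X] [BorelSpace X] (μ : Measure X) [IsFiniteMeasure μ] [NullSingletonClass μ]
    {η : ℝ≥0∞} (hη : η ≠ 0) : ∃ δ : ℝ, 0 < δ ∧ μ.prod μ {p | dist p.1 p.2 ≤ δ} < η := by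
  have hm : ∀ δ : ℝ, MeasurableSet {p : X × X | dist p.1 p.2 ≤ δ} := fun δ =>
    measurableSet_le measurable_dist measurable_const
  have ht := tendsto_measure_iInter_atTop (μ := μ.prod μ)
    (s := fun n : ℕ => {p : X × X | dist p.1 p.2 ≤ 1 / ((n : ℝ) + 1)})
    (fun n => (hm _).nullMeasurableSet)
    (fun m n hmn => ofPred_subset_ofPred.2 fun p hp => hp.trans (by gcongr))
    ⟨0, measure_ne_top _ _⟩
  have h0 : (μ.prod μ) (⋂ n : ℕ, {p : X × X | dist p.1 p.2 ≤ 1 / ((n : ℝ) + 1)}) = 0 := by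
    rw [Measure.measure_prod_null (MeasurableSet.iInter fun n => hm _)]
    refine ae_of_all _ fun x => measure_mono_null (t := {x}) (fun y hy => ?_) (measure_singleton x)
    simp only [mem_preimage, mem_iInter] at hy
    have : dist x y ≤ 0 := ge_of_tendsto' tendsto_one_div_add_atTop_nhds_zero_nat hy
    exact (dist_le_zero.1 this).symm
  rw [h0] at ht
  obtain ⟨n, hn⟩ := (ht.eventually_lt_const (pos_iff_ne_zero.2 hη)).exists
  exact ⟨1 / ((n : ℝ) + 1), by positivity, hn⟩

/-- The energy `∬ ν ((f a + C) ∩ (f b + C)) dμ(a) dμ(b)`, which is the squared `L²` norm of the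
convolution of `f_* μ` with the indicator of `C`. The intersection is translated by `-f b`. -/
noncomputable def translateEnergy {X : Type*} [MeasurableSpace X] (μ : Measure X) (f : X → E)
    (C : Set E) : ℝ≥0∞ :=
  ∫⁻ p, ν ((· + (f p.2 - f p.1)) ⁻¹' C ∩ C) ∂(μ.prod μ)

/-- The Cauchy–Schwarz lower bound for the measure of `f '' A + C`. -/
theorem measure_sq_le_translateEnergy_mul {X : Type*} [MeasurableSpace X] (μ : Measure X)
    [IsProbabilityMeasure μ] {f : X → E} (hf : Measurable f) {A : Set X} (hA : μ Aᶜ = 0)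
    {C : Set E} (hC : MeasurableSet C) (hS : MeasurableSet (f '' A + C)) :
    ν C ^ 2 ≤ translateEnergy ν μ f C * ν (f '' A + C) := by
  set S := f '' A + C
  set F : E → ℝ≥0∞ := fun t => μ {a | t - f a ∈ C} with hF
  have hQ : MeasurableSet {q : E × X | q.1 - f q.2 ∈ C} :=
    (measurable_fst.sub (hf.comp measurable_snd)) hC
  have hFm : Measurable F := measurable_measure_prodMk_left hQ
  have hFS : ∀ t, F t = (F * (S.indicator 1 : E → ℝ≥0∞)) t := fun t => by
    by_cases ht : t ∈ S
    · simp [ht]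
    · have : F t = 0 := by
        refine measure_mono_null (t := Aᶜ) (fun a ha haA => ht ?_) hA
        exact ⟨f a, mem_image_of_mem f haA, t - f a, ha, by simp⟩
      simp [this]
  have h1 : ∫⁻ t, F t ∂ν = ν C := by
    have e1 := Measure.prod_apply (μ := ν) (ν := μ) hQ
    have e2 := Measure.prod_apply_symm (μ := ν) (ν := μ) hQ
    calc ∫⁻ t, F t ∂ν = (ν.prod μ) {q : E × X | q.1 - f q.2 ∈ C} := e1.symm
      _ = ∫⁻ _, ν C ∂μ := by
        rw [e2]
        congr 1 with a
        rw [← measure_preimage_add_right ν (-f a) C]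
        congr 1 with t
        simp [sub_eq_add_neg]
      _ = ν C := by simp
  have h2 : ∫⁻ t, F t ^ (2 : ℝ) ∂ν = translateEnergy ν μ f C := by
    have hR : MeasurableSet {q : E × (X × X) | q.1 - f q.2.1 ∈ C ∧ q.1 - f q.2.2 ∈ C} := by
      apply MeasurableSet.inter
      · exact (measurable_fst.sub (hf.comp (measurable_fst.comp measurable_snd))) hC
      · exact (measurable_fst.sub (hf.comp (measurable_snd.comp measurable_snd))) hC
    have e1 := Measure.prod_apply (μ := ν) (ν := μ.prod μ) hR
    have e2 := Measure.prod_apply_symm (μ := ν) (ν := μ.prod μ) hR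
    rw [translateEnergy]
    calc ∫⁻ t, F t ^ (2 : ℝ) ∂ν
        = (ν.prod (μ.prod μ)) {q : E × (X × X) | q.1 - f q.2.1 ∈ C ∧ q.1 - f q.2.2 ∈ C} := by
          rw [e1]
          congr 1 with t
          rw [ENNReal.rpow_two, sq, hF, ← Measure.prod_prod]
          rfl
      _ = _ := by
          rw [e2]
          congr 1 with p
          rw [← measure_preimage_add_right ν (f p.2)]
          congr 1 with u
          simp [add_sub_assoc]
  have h3 := ENNReal.lintegral_mul_le_Lp_mul_Lq ν Real.HolderConjugate.two_two
    hFm.aemeasurable ((measurable_one.indicator hS).aemeasurable (μ := ν) (f := S.indicator 1))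
  have h4 : ∫⁻ t, (S.indicator (1 : E → ℝ≥0∞) t) ^ (2 : ℝ) ∂ν = ν S := by
    rw [← lintegral_indicator_one hS]
    congr 1 with t
    by_cases ht : t ∈ S <;> simp [ht]
  rw [← lintegral_congr hFS, h1, h2, h4] at h3
  calc ν C ^ 2 ≤ (translateEnergy ν μ f C ^ (1 / 2 : ℝ) * ν S ^ (1 / 2 : ℝ)) ^ 2 := by gcongr
    _ = _ := by
      rw [← ENNReal.mul_rpow_of_nonneg _ _ (by norm_num), ← ENNReal.rpow_two, ← ENNReal.rpow_mul]
      norm_num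

/-- One halving step: `ν C ^ 2` is divided by about `4`, and so is the energy of `C` along every
map with the given expansion bound. -/
theorem exists_isCompact_half_translateEnergy [Nontrivial E] {X : Type*} [MetricSpace X]
    [SecondCountableTopology X] [MeasurableSpace X] [BorelSpace X] (μ : Measure X)
    [IsProbabilityMeasure μ] [NullSingletonClass μ] {C : Set E} (hC : IsCompact C) (L : ℝ≥0) {η : ℝ}
    (hη : 0 < η) :
    ∃ C' ⊆ C, IsCompact C' ∧ |2 * ν.real C' - ν.real C| ≤ η ∧
      ∀ f : X → E, AntilipschitzWith L f →
        4 * translateEnergy ν μ f C' ≤ translateEnergy ν μ f C + ENNReal.ofReal η := by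
  have hCfin : ν C ≠ ∞ := hC.measure_lt_top.ne
  set V : ℝ≥0∞ := 4 * ν C + 1 with hV
  have hVtop : V ≠ ∞ := by finiteness
  have hη2 : ENNReal.ofReal (η / 2) ≠ 0 := by simpa using hη
  obtain ⟨δ, hδ, hδV⟩ := exists_prod_dist_le_lt μ
    (ENNReal.div_ne_zero.2 ⟨hη2, hVtop⟩ : ENNReal.ofReal (η / 2) / V ≠ 0)
  have hLpos : (0 : ℝ) < (L : ℝ) + 1 := by positivity
  obtain ⟨C', hC'C, hC', hv, hc⟩ := exists_isCompact_half ν hC (div_pos hδ hLpos) (half_pos hη)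
  refine ⟨C', hC'C, hC', hv.trans (half_le_self hη.le), fun f hf => ?_⟩
  set N : Set (X × X) := {p | dist p.1 p.2 ≤ δ} with hN
  have hNm : MeasurableSet N := measurableSet_le measurable_dist measurable_const
  have key : ∀ p : X × X, 4 * ν ((· + (f p.2 - f p.1)) ⁻¹' C' ∩ C') ≤
      ν ((· + (f p.2 - f p.1)) ⁻¹' C ∩ C) +
        (ENNReal.ofReal (η / 2) + N.indicator (fun _ => V) p) := fun p => by
    set z := f p.2 - f p.1 with hz
    have hfin : ∀ D ⊆ C, ν ((· + z) ⁻¹' D ∩ D) ≠ ∞ := fun D hD =>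
      ((measure_mono (inter_subset_right.trans hD)).trans_lt hC.measure_lt_top).ne
    by_cases hzs : δ / (L + 1) ≤ ‖z‖
    · have h1 := ENNReal.ofReal_le_ofReal (hc z hzs)
      rw [ENNReal.ofReal_mul (by norm_num), ENNReal.ofReal_add (by positivity) (by positivity),
        measureReal_def, measureReal_def, ENNReal.ofReal_toReal (hfin _ hC'C),
        ENNReal.ofReal_toReal (hfin _ subset_rfl)] at h1
      rw [← add_assoc]
      refine le_trans (le_trans (le_of_eq ?_) h1) le_self_add
      norm_num
    · have hp : p ∈ N := by
        have h1 := hf.le_mul_dist p.2 p.1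
        rw [dist_eq_norm (f p.2), dist_comm] at h1
        have h2 : ‖z‖ * (L + 1) < δ := (lt_div_iff₀ hLpos).1 (not_le.1 hzs)
        have h3 : (L : ℝ) * ‖z‖ ≤ ‖z‖ * (L + 1) := by nlinarith [norm_nonneg z]
        exact h1.trans (h3.trans h2.le)
      rw [indicator_of_mem hp]
      calc 4 * ν ((· + z) ⁻¹' C' ∩ C') ≤ 4 * ν C := by
            gcongr
            exact inter_subset_right.trans hC'C
        _ ≤ V := le_self_add
        _ ≤ _ := le_add_self.trans le_add_self
  calc 4 * translateEnergy ν μ f C'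
      = ∫⁻ p, 4 * ν ((· + (f p.2 - f p.1)) ⁻¹' C' ∩ C') ∂(μ.prod μ) :=
        (lintegral_const_mul' _ _ (by norm_num)).symm
    _ ≤ ∫⁻ p, (ν ((· + (f p.2 - f p.1)) ⁻¹' C ∩ C) +
        (ENNReal.ofReal (η / 2) + N.indicator (fun _ => V) p)) ∂(μ.prod μ) := lintegral_mono key
    _ = translateEnergy ν μ f C + (ENNReal.ofReal (η / 2) + V * (μ.prod μ) N) := by
        have hm : Measurable fun p => ENNReal.ofReal (η / 2) + N.indicator (fun _ => V) p :=
          (measurable_const.indicator hNm).const_add _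
        rw [lintegral_add_right _ hm,
          lintegral_add_left measurable_const, lintegral_indicator_const hNm]
        simp [translateEnergy]
    _ ≤ translateEnergy ν μ f C + (ENNReal.ofReal (η / 2) + ENNReal.ofReal (η / 2)) := by
        gcongr
        rw [mul_comm]
        exact (ENNReal.le_div_iff_mul_le (Or.inl (by simp [hV])) (Or.inl hVtop)).1 hδV.le
    _ = _ := by
        rw [← ENNReal.ofReal_add (by positivity) (by positivity), add_halves]

/-! ### A compact null set with sums of positive measure -/

/-- Iterated halving, with the expansion bound `k` and a summable error at the `k`-th step: along
the resulting sequence `2 ^ k * ν (C k)` stays away from `0` and `∞`, and `4 ^ k` times the energy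
along any given expanding map stays bounded. -/
theorem exists_seq_isCompact_half [Nontrivial E] {X : Type*} [MetricSpace X]
    [SecondCountableTopology X] [MeasurableSpace X] [BorelSpace X] (μ : Measure X)
    [IsProbabilityMeasure μ] [NullSingletonClass μ] :
    ∃ (C : ℕ → Set E) (V : ℝ), 0 < V ∧ (∀ k, IsCompact (C k)) ∧ Antitone C ∧
      (∀ k, V ≤ 2 ^ k * ν.real (C k)) ∧ (∀ k, 2 ^ k * ν.real (C k) ≤ 3 * V) ∧
      ∀ (f : X → E) (L : ℝ≥0), AntilipschitzWith L f →
        ∃ M : ℝ≥0∞, M ≠ ∞ ∧ ∀ᶠ k in atTop, 4 ^ k * translateEnergy ν μ f (C k) ≤ M := by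
  have := FiniteDimensional.proper ℝ E
  set C₀ : Set E := Metric.closedBall 0 1 with hC₀
  have hC₀c : IsCompact C₀ := isCompact_closedBall 0 1
  set U : ℝ := ν.real C₀ with hU
  have hUpos : 0 < U :=
    ENNReal.toReal_pos (Metric.measure_closedBall_pos ν 0 one_pos).ne' hC₀c.measure_lt_top.ne
  set c : ℝ := min 1 U with hc
  have hcpos : 0 < c := lt_min one_pos hUpos
  -- With this error at the `k`-th step, `2 ^ k * ν (C k)` moves by at most `U * (1 / 2) ^ (k + 2)`
  -- and `4 ^ k` times the energy grows by at most `(1 / 2) ^ k`.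
  have step : ∀ (k : ℕ) (C : {C : Set E // IsCompact C}), ∃ C' : {C : Set E // IsCompact C},
      C'.1 ⊆ C.1 ∧ |2 * ν.real C'.1 - ν.real C.1| ≤ c * (1 / 8) ^ (k + 1) ∧
      ∀ f : X → E, AntilipschitzWith (k : ℝ≥0) f →
        4 * translateEnergy ν μ f C'.1 ≤
          translateEnergy ν μ f C.1 + ENNReal.ofReal (c * (1 / 8) ^ (k + 1)) := fun k C => by
    obtain ⟨C', h1, h2, h3, h4⟩ := exists_isCompact_half_translateEnergy ν μ C.2 (k : ℝ≥0)
      (show 0 < c * (1 / 8) ^ (k + 1) by positivity)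
    exact ⟨⟨C', h2⟩, h1, h3, h4⟩
  choose F hFsub hFv hFe using step
  set D : ℕ → {C : Set E // IsCompact C} := fun n => Nat.rec ⟨C₀, hC₀c⟩ F n with hD
  have hDs : ∀ k, D (k + 1) = F k (D k) := fun k => rfl
  have hbound : ∀ k, |2 ^ k * ν.real (D k).1 - U| ≤ U * (1 / 2 - (1 / 2) ^ (k + 1)) := by
    intro k
    induction k with
    | zero => simp [hD, hU]
    | succ k ih =>
      have h1 := hFv k (D k)
      rw [← hDs] at h1
      have h2 : |2 ^ (k + 1) * ν.real (D (k + 1)).1 - 2 ^ k * ν.real (D k).1| ≤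
          U * (1 / 2) ^ (k + 2) := by
        have e : 2 ^ (k + 1) * ν.real (D (k + 1)).1 - 2 ^ k * ν.real (D k).1 =
            2 ^ k * (2 * ν.real (D (k + 1)).1 - ν.real (D k).1) := by ring
        rw [e, abs_mul, abs_of_pos (by positivity)]
        have h8 : (2 : ℝ) ^ k * (1 / 8) ^ (k + 1) ≤ (1 / 2) ^ (k + 2) := by
          have e8 : (2 : ℝ) ^ k * (1 / 8) ^ (k + 1) = (1 / 4) ^ k * (1 / 8) := by
            rw [pow_succ, ← mul_assoc, ← mul_pow]; norm_num
          rw [e8, pow_add]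
          gcongr <;> norm_num
        calc 2 ^ k * |2 * ν.real (D (k + 1)).1 - ν.real (D k).1|
            ≤ 2 ^ k * (c * (1 / 8) ^ (k + 1)) := by gcongr
          _ = c * (2 ^ k * (1 / 8) ^ (k + 1)) := by ring
          _ ≤ U * (1 / 2) ^ (k + 2) := by
            gcongr
            exact min_le_right _ _
      have e : U * (1 / 2 - (1 / 2) ^ (k + 1 + 1)) =
          U * (1 / 2) ^ (k + 2) + U * (1 / 2 - (1 / 2) ^ (k + 1)) := by ring
      rw [e]
      refine le_trans (le_of_eq ?_) ((abs_add_le _ _).trans (add_le_add h2 ih))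
      ring_nf
  have hbound' : ∀ k, |2 ^ k * ν.real (D k).1 - U| ≤ U / 2 := fun k => (hbound k).trans (by
    have : 0 < U * (1 / 2) ^ (k + 1) := by positivity
    linarith)
  refine ⟨fun k => (D k).1, U / 2, by positivity, fun k => (D k).2,
    antitone_nat_of_succ_le fun k => hFsub k (D k), fun k => ?_, fun k => ?_, fun f L hf => ?_⟩
  · linarith [(abs_le.1 (hbound' k)).1]
  · linarith [(abs_le.1 (hbound' k)).2]
  · obtain ⟨K, hK⟩ := exists_nat_ge L
    have hgrow : ∀ j, 4 ^ (K + j) * translateEnergy ν μ f (D (K + j)).1 ≤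
        4 ^ K * translateEnergy ν μ f (D K).1 +
          ∑ i ∈ Finset.range j, ENNReal.ofReal ((1 / 2) ^ i) := by
      intro j
      induction j with
      | zero => simp
      | succ j ih =>
        have hL : L ≤ ((K + j : ℕ) : ℝ≥0) := hK.trans (by exact_mod_cast Nat.le_add_right K j)
        have h1 := hFe (K + j) (D (K + j)) f fun x y => (hf x y).trans (by gcongr)
        rw [← hDs] at h1
        have h8 : (4 : ℝ) ^ (K + j) * (c * (1 / 8) ^ (K + j + 1)) ≤ (1 / 2) ^ j := by
          have e8 : (4 : ℝ) ^ (K + j) * (c * (1 / 8) ^ (K + j + 1)) =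
              (1 / 2) ^ j * ((1 / 2) ^ K * (c * (1 / 8))) := by
            rw [show (1 / 8 : ℝ) = 1 / 4 * (1 / 2) by norm_num, mul_pow, one_div_pow 4]
            field_simp
            ring
          rw [e8]
          refine mul_le_of_le_one_right (by positivity) ?_
          have : (1 / 2 : ℝ) ^ K ≤ 1 := pow_le_one₀ (by norm_num) (by norm_num)
          have : c ≤ 1 := min_le_left _ _
          nlinarith
        calc 4 ^ (K + (j + 1)) * translateEnergy ν μ f (D (K + (j + 1))).1
            = 4 ^ (K + j) * (4 * translateEnergy ν μ f (D (K + j + 1)).1) := by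
              rw [← mul_assoc, ← pow_succ]; rfl
          _ ≤ 4 ^ (K + j) * (translateEnergy ν μ f (D (K + j)).1 +
                ENNReal.ofReal (c * (1 / 8) ^ (K + j + 1))) := by gcongr
          _ = 4 ^ (K + j) * translateEnergy ν μ f (D (K + j)).1 +
                ENNReal.ofReal (4 ^ (K + j) * (c * (1 / 8) ^ (K + j + 1))) := by
              rw [mul_add, ENNReal.ofReal_mul (p := 4 ^ (K + j)) (by positivity),
                ENNReal.ofReal_pow (by norm_num)]
              norm_num
          _ ≤ _ := by
              rw [Finset.sum_range_succ, ← add_assoc]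
              gcongr
    have hfin : translateEnergy ν μ f (D K).1 ≠ ∞ := by
      refine ((lintegral_mono (g := fun _ => ν (D K).1) fun p =>
        measure_mono inter_subset_right).trans_lt ?_).ne
      simpa using (D K).2.measure_lt_top
    refine ⟨4 ^ K * translateEnergy ν μ f (D K).1 + 2, by finiteness, ?_⟩
    filter_upwards [eventually_ge_atTop K] with k hk
    obtain ⟨j, rfl⟩ := Nat.exists_eq_add_of_le hk
    refine (hgrow j).trans ?_
    gcongr
    rw [← ENNReal.ofReal_sum_of_nonneg fun i _ => by positivity]
    refine ENNReal.ofReal_le_of_le_toReal ?_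
    exact (summable_geometric_two.sum_le_tsum _ fun i _ => by positivity).trans_eq
      (by rw [tsum_geometric_two]; simp)

theorem add_iInter_eq_of_isCompact_of_antitone {G : Type*} [AddCommGroup G] [TopologicalSpace G]
    [IsTopologicalAddGroup G] [T2Space G] {K : Set G} (hK : IsCompact K) {C : ℕ → Set G}
    (hC : ∀ k, IsClosed (C k)) (hanti : Antitone C) : K + ⋂ k, C k = ⋂ k, (K + C k) := by
  refine Subset.antisymm (subset_iInter fun k => add_subset_add_left (iInter_subset _ k))
    fun t ht => ?_
  have hcl : ∀ k, IsClosed (K ∩ (fun a => t - a) ⁻¹' C k) := fun k =>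
    hK.isClosed.inter ((hC k).preimage (by fun_prop))
  obtain ⟨a, ha⟩ := IsCompact.nonempty_iInter_of_sequence_nonempty_isCompact_isClosed
    (fun k => K ∩ (fun a => t - a) ⁻¹' C k)
    (fun k => inter_subset_inter_right _ (preimage_mono (hanti k.le_succ)))
    (fun k => by
      obtain ⟨a, ha, b, hb, hab⟩ := mem_iInter.1 ht k
      refine ⟨a, ha, ?_⟩
      rw [mem_preimage, ← hab]
      simpa using hb)
    (hK.of_isClosed_subset (hcl 0) inter_subset_left) hcl
  rw [mem_iInter] at ha
  exact ⟨a, (ha 0).1, t - a, mem_iInter.2 fun k => (ha k).2, by simp⟩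

/-- Every compact set carrying an atomless probability measure admits a compact null set whose
sum with each of its bi-Lipschitz images has positive measure. -/
theorem exists_isCompact_null_measure_image_add_ne_zero [Nontrivial E] {X : Type*} [MetricSpace X]
    [SecondCountableTopology X] [MeasurableSpace X] [BorelSpace X] (μ : Measure X)
    [IsProbabilityMeasure μ] [NullSingletonClass μ] {A : Set X} (hA : IsCompact A)
    (hμA : μ Aᶜ = 0) :
    ∃ C : Set E, IsCompact C ∧ ν C = 0 ∧
      ∀ (f : X → E) (L : ℝ≥0), Continuous f → AntilipschitzWith L f → ν (f '' A + C) ≠ 0 := by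
  obtain ⟨C, V, hV, hCc, hanti, hlow, hup, hen⟩ := exists_seq_isCompact_half ν μ
  have hCi : IsCompact (⋂ k, C k) := (hCc 0).of_isClosed_subset
    (isClosed_iInter fun k => (hCc k).isClosed) (iInter_subset _ 0)
  refine ⟨⋂ k, C k, hCi, ?_, fun f L hfc hfL h0 => ?_⟩
  · have hle : ∀ k, ν.real (⋂ k, C k) ≤ 3 * V * (1 / 2) ^ k := fun k => by
      refine (measureReal_mono (iInter_subset _ k) (hCc k).measure_lt_top.ne).trans ?_
      rw [one_div_pow, mul_one_div, le_div_iff₀ (by positivity), mul_comm]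
      exact hup k
    have hlim : Tendsto (fun k : ℕ => 3 * V * (1 / 2 : ℝ) ^ k) atTop (𝓝 (3 * V * 0)) :=
      (tendsto_pow_atTop_nhds_zero_of_lt_one (by norm_num) (by norm_num)).const_mul _
    rw [mul_zero] at hlim
    have h := le_antisymm (ge_of_tendsto' hlim hle) measureReal_nonneg
    exact (measureReal_eq_zero_iff hCi.measure_lt_top.ne).1 h
  · obtain ⟨M, hM, hMk⟩ := hen f L hfL
    have hK : IsCompact (f '' A) := hA.image hfc
    have hSc : ∀ k, IsCompact (f '' A + C k) := fun k => hK.add (hCc k)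
    rw [add_iInter_eq_of_isCompact_of_antitone hK (fun k => (hCc k).isClosed) hanti] at h0
    have hlim := tendsto_measure_iInter_atTop (μ := ν)
      (fun k => (hSc k).measurableSet.nullMeasurableSet)
      (fun i j hij => add_subset_add_left (hanti hij)) ⟨0, (hSc 0).measure_lt_top.ne⟩
    rw [h0] at hlim
    have hlim' := ENNReal.Tendsto.const_mul hlim (Or.inr hM)
    rw [mul_zero] at hlim'
    refine absurd (ge_of_tendsto hlim' (b := ENNReal.ofReal V ^ 2) ?_) (by simpa using hV)
    filter_upwards [hMk] with k hk
    have h1 := measure_sq_le_translateEnergy_mul ν μ hfc.measurable hμA (hCc k).measurableSet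
      (hSc k).measurableSet
    have h2 : ENNReal.ofReal V ≤ 2 ^ k * ν (C k) := by
      refine (ENNReal.ofReal_le_ofReal (hlow k)).trans_eq ?_
      rw [ENNReal.ofReal_mul (by positivity), ENNReal.ofReal_pow (by norm_num), measureReal_def,
        ENNReal.ofReal_toReal (hCc k).measure_lt_top.ne]
      norm_num
    calc ENNReal.ofReal V ^ 2 ≤ (2 ^ k * ν (C k)) ^ 2 := by gcongr
      _ = 4 ^ k * ν (C k) ^ 2 := by rw [mul_pow, ← pow_mul, mul_comm k, pow_mul]; norm_num
      _ ≤ 4 ^ k * (translateEnergy ν μ f (C k) * ν (f '' A + C k)) := by gcongr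
      _ = (4 ^ k * translateEnergy ν μ f (C k)) * ν (f '' A + C k) := by rw [mul_assoc]
      _ ≤ M * ν (f '' A + C k) := by gcongr

/-! ### From positive to full measure -/

/-- The sum of a set of positive measure and a dense set is conull: `v ↦ ν (T ∩ (S - v))`,
where `T` is the complement of the sum, is continuous, vanishes on the dense set `-D` and has integral
`ν S * ν T`. -/
theorem measure_compl_add_eq_zero_of_dense {S : Set E} (hS : IsCompact S) (hS0 : ν S ≠ 0)
    {D : Set E} (hDc : D.Countable) (hD : Dense D) :
    ν (S + D)ᶜ = 0 := by
  have hSm := hS.measurableSet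
  have hSD : MeasurableSet (S + D) := by
    rw [← iUnion_add_right_image]
    refine MeasurableSet.biUnion hDc fun d _ => ?_
    rw [image_add_right]
    exact measurable_add_const _ hSm
  set T := (S + D)ᶜ with hT
  have hTm : MeasurableSet T := hSD.compl
  have hSint : Integrable (S.indicator (1 : E → ℝ)) ν :=
    (integrable_indicator_iff hSm).2 (integrableOn_const hS.measure_lt_top.ne)
  have hzero : ∀ v : E, ν (T ∩ (· + v) ⁻¹' S) = 0 := by
    intro v
    have hfin : ν ((· + v) ⁻¹' S) ≠ ∞ := by
      rw [measure_preimage_add_right]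
      exact hS.measure_lt_top.ne
    have hDv : ∀ d ∈ D, ν.real (T ∩ (· + v) ⁻¹' S) ≤
        ∫ t, |S.indicator 1 (t + (v + d)) - S.indicator 1 t| ∂ν := fun d hd => by
      have hm : MeasurableSet (T ∩ (· + v) ⁻¹' S) := hTm.inter (measurable_add_const v hSm)
      have hi : Integrable (fun t => |S.indicator (1 : E → ℝ) (t + (v + d)) - S.indicator 1 t|) ν :=
        ((hSint.comp_add_right (v + d)).sub hSint).abs
      rw [← integral_add_right_eq_self
        (fun t => |S.indicator (1 : E → ℝ) (t + (v + d)) - S.indicator 1 t|) (-d),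
        ← integral_indicator_one hm]
      refine integral_mono ((integrable_indicator_iff hm).2 (integrableOn_const
        ((measure_mono inter_subset_right).trans_lt hfin.lt_top).ne)) (hi.comp_add_right (-d))
        fun t => ?_
      by_cases ht : t ∈ T ∩ (· + v) ⁻¹' S
      · have h1 : t + -d ∉ S := fun h => ht.1 ⟨t + -d, h, d, hd, by simp⟩
        have h2 : t + v ∈ S := ht.2
        have h3 : t + -d + (v + d) = t + v := by abel
        simp [ht, h1, h2, h3]
      · simp [ht]
    have hlim : ∀ ε > 0, ν.real (T ∩ (· + v) ⁻¹' S) ≤ ε := fun ε hε => by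
      have hev := (tendsto_integral_abs_translate_sub ν hSint).eventually_le_const hε
      have hev' : ∀ᶠ d in 𝓝 (-v), ∫ t, |S.indicator 1 (t + (v + d)) - S.indicator 1 t| ∂ν ≤ ε :=
        ((continuous_const.add continuous_id).tendsto' (-v) 0 (add_neg_cancel v)).eventually hev
      obtain ⟨d, hd, hdD⟩ := (mem_closure_iff_frequently.1 (hD (-v))).and_eventually hev' |>.exists
      exact (hDv d hd).trans hdD
    exact (measureReal_eq_zero_iff
      ((measure_mono inter_subset_right).trans_lt hfin.lt_top).ne).1
      (le_antisymm (le_of_forall_gt_imp_ge_of_dense hlim) measureReal_nonneg)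
  have hQ : MeasurableSet {q : E × E | q.1 ∈ T ∧ q.1 + q.2 ∈ S} :=
    (measurable_fst hTm).inter ((measurable_fst.add measurable_snd) hSm)
  have e1 := Measure.prod_apply (μ := ν) (ν := ν) hQ
  have e2 : (ν.prod ν) {q : E × E | q.1 ∈ T ∧ q.1 + q.2 ∈ S} = ∫⁻ _ : E, 0 ∂ν := by
    rw [Measure.prod_apply_symm hQ]
    exact lintegral_congr hzero
  have e3 : ∀ t, ν (Prod.mk t ⁻¹' {q : E × E | q.1 ∈ T ∧ q.1 + q.2 ∈ S}) =
      T.indicator (fun _ => ν S) t := fun t => by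
    by_cases ht : t ∈ T
    · rw [indicator_of_mem ht, ← measure_preimage_add ν t S]
      congr 1 with v
      simp [ht]
    · simp [ht]
  rw [e2, lintegral_congr e3, lintegral_indicator_const hTm, lintegral_zero] at e1
  exact (mul_eq_zero.1 e1.symm).resolve_left hS0

end HaarMeasure

/-! ### Cantor sets -/

theorem IsCantorSet.isCompact {X : Type*} [TopologicalSpace X] {A : Set X} (hA : IsCantorSet A) :
    IsCompact A := by
  obtain ⟨e⟩ := hA
  exact isCompact_iff_compactSpace.2 e.symm.compactSpace

theorem IsCantorSet.not_countable {X : Type*} [TopologicalSpace X] {A : Set X}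
    (hA : IsCantorSet A) : ¬ A.Countable := by
  obtain ⟨e⟩ := hA
  intro h
  have : Countable A := h
  have : Countable (ℕ → Bool) := e.symm.injective.countable
  have hle := Cardinal.mk_le_aleph0 (α := ℕ → Bool)
  rw [← Cardinal.power_def, Cardinal.mk_bool, Cardinal.mk_nat] at hle
  exact (Cardinal.cantor _).not_ge hle

/-- An uncountable Borel subset of a Polish space carries an atomless probability measure: the
image of Lebesgue measure on `[0, 1]` under a Borel isomorphism from `ℝ`. -/
theorem exists_isProbabilityMeasure_nullSingletonClass {X : Type*} [TopologicalSpace X]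
    [PolishSpace X] [MeasurableSpace X] [BorelSpace X] {A : Set X} (hA : MeasurableSet A)
    (hc : ¬ A.Countable) :
    ∃ μ : Measure X, IsProbabilityMeasure μ ∧ NullSingletonClass μ ∧ μ Aᶜ = 0 := by
  have := hA.standardBorel
  let e : ℝ ≃ᵐ A := PolishSpace.measurableEquivOfNotCountable
    (fun h => Cardinal.not_countable_real (Set.countable_univ_iff.2 h)) hc
  have hm : Measurable fun x : ℝ => (e x : X) := measurable_subtype_coe.comp e.measurable
  have hp : IsProbabilityMeasure (volume.restrict (Icc (0 : ℝ) 1)) := ⟨by simp⟩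
  refine ⟨(volume.restrict (Icc (0 : ℝ) 1)).map fun x => (e x : X),
    Measure.isProbabilityMeasure_map hm.aemeasurable, ⟨fun a => ?_⟩, ?_⟩
  · rw [Measure.map_apply hm (measurableSet_singleton a)]
    refine Set.Subsingleton.measure_zero (fun x hx y hy => ?_) _
    exact e.injective (Subtype.ext (Eq.trans hx (Eq.symm hy)))
  · rw [Measure.map_apply hm hA.compl]
    convert measure_empty (μ := volume.restrict (Icc (0 : ℝ) 1))
    ext x
    simp

theorem IsBiLipschitz.neg {X Y : Type*} [PseudoEMetricSpace X] [NormedAddCommGroup Y] {f : X → Y}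
    (hf : IsBiLipschitz f) : IsBiLipschitz fun x => -f x := by
  obtain ⟨⟨K, hK⟩, L, hL⟩ := hf
  exact ⟨⟨K, fun x y => by simpa only [edist_neg_neg] using hK x y⟩,
    L, fun x y => by simpa only [edist_neg_neg] using hL x y⟩

theorem isFSigma_add_countable {G : Type*} [TopologicalSpace G] [AddGroup G] [ContinuousAdd G]
    [T2Space G] {C D : Set G} (hC : IsCompact C) (hD : D.Countable) : IsFSigma (C + D) := by
  rcases D.eq_empty_or_nonempty with rfl | hne
  · exact ⟨fun _ => ∅, fun _ => isClosed_empty, by simp⟩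
  · obtain ⟨u, rfl⟩ := hD.exists_eq_range hne
    refine ⟨fun n => (· + u n) '' C, fun n => (hC.image (by fun_prop)).isClosed, ?_⟩
    rw [← iUnion_add_right_image, biUnion_range]

/-- `F_σ` null sets whose sum with every bi-Lipschitz image of a Cantor set is conull. -/
theorem IsCantorSet.exists_isFSigma_null {E : Type*} [NormedAddCommGroup E] [NormedSpace ℝ E]
    [FiniteDimensional ℝ E] [MeasurableSpace E] [BorelSpace E] (ν : Measure E)
    [ν.IsAddHaarMeasure] {A : Set E} (hA : IsCantorSet A) :
    ∃ B : Set E, IsFSigma B ∧ ν B = 0 ∧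
      ∀ f : E → E, IsBiLipschitz f → ν (f '' A + B)ᶜ = 0 := by
  have := FiniteDimensional.proper ℝ E
  have : Nontrivial E := by
    by_contra h
    have := not_nontrivial_iff_subsingleton.1 h
    exact hA.not_countable (Set.to_countable A)
  obtain ⟨μ, hμ, hμ', hμA⟩ := exists_isProbabilityMeasure_nullSingletonClass
    hA.isCompact.measurableSet hA.not_countable
  obtain ⟨C, hC, hC0, hCf⟩ :=
    exists_isCompact_null_measure_image_add_ne_zero ν μ hA.isCompact hμA
  obtain ⟨D, hDc, hD⟩ := TopologicalSpace.exists_countable_dense E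
  refine ⟨C + D, isFSigma_add_countable hC hDc, ?_, fun f ⟨⟨K, hK⟩, L, hL⟩ => ?_⟩
  · rw [← iUnion_add_right_image, measure_biUnion_null_iff hDc]
    intro d _
    rw [image_add_right, measure_preimage_add_right, hC0]
  · rw [← add_assoc]
    exact measure_compl_add_eq_zero_of_dense ν ((hA.isCompact.image hK.continuous).add hC)
      (hCf f L hK.continuous hL) hDc hD

theorem mainTheorem3 (d : ℕ) (A : Set (EuclideanSpace ℝ (Fin d))) (hA : IsCantorSet A) :
    (∃ B : Set (EuclideanSpace ℝ (Fin d)), IsFSigma B ∧ volume B = 0 ∧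
      ∀ f : EuclideanSpace ℝ (Fin d) → EuclideanSpace ℝ (Fin d), IsBiLipschitz f →
        volume (f '' A + B)ᶜ = 0) ∧
    (∃ X : Set (EuclideanSpace ℝ (Fin d)), Dense X ∧ IsGδ X ∧ volume Xᶜ = 0 ∧
      ∀ f : EuclideanSpace ℝ (Fin d) → EuclideanSpace ℝ (Fin d), IsBiLipschitz f →
        volume {t : EuclideanSpace ℝ (Fin d) | (fun x => f x + t) '' A ⊆ X} = 0) := by
  obtain ⟨B, hBσ, hB0, hB⟩ := hA.exists_isFSigma_null volume
  refine ⟨⟨B, hBσ, hB0, hB⟩, Bᶜ, ?_, ?_, by rwa [compl_compl], fun f hf => ?_⟩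
  · exact Measure.dense_of_ae (μ := volume) (compl_mem_ae_iff.2 hB0)
  · obtain ⟨F, hF, rfl⟩ := hBσ
    rw [compl_iUnion]
    exact IsGδ.iInter_of_isOpen fun n => (hF n).isOpen_compl
  · -- If `f '' A + t` misses `B`, then `t` lies outside `-f '' A + B`.
    refine measure_mono_null (fun t ht => ?_) (hB _ hf.neg)
    rintro ⟨_, ⟨a, ha, rfl⟩, b, hb, rfl⟩
    exact ht ⟨a, ha, rfl⟩ (by simpa using hb)
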